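/- Let $\Bbbk$ be a field and $\Bbbk\langle E_1,E_2\rangle$ the free associative algebra on two generators, indexed by the alphabet $\{1,2\}$ with $1\prec 2$; order words lexicographically, a proper prefix being smaller. A nonempty word $\alpha$ is a Lyndon word if $\alpha\prec\gamma\beta$ for every factorization $\alpha=\beta\gamma$ into nonempty words. For a Lyndon word $\alpha$ let $E_\alpha$ be the corresponding generator if $\alpha$ is a letter, and otherwise $E_\alpha=E_\beta E_\gamma-E_\gamma E_\beta$, where $\alpha=\beta\gamma$ with $\beta,\gamma$ Lyndon and $\gamma$ of maximal length. The products $E_{\alpha_1}E_{\alpha_2}\cdots E_{\alpha_m}$ with $m\ge 0$, $\alpha_i$ Lyndon and $\alpha_1\succeq\alpha_2\succeq\cdots\succeq\alpha_m$ form a basis of $\Bbbk\langle E_1,E_2\rangle$ (the Lyndon–Shirshov PBW basis); the terms of an element are the terms of its expansion in this basis. For $i,j\ge 0$ let $\mathcal{SH}_{i,j}=\mathcal{SH}_{i,j}(E_2,E_1)$ be the sum of all words with exactly $i$ letters $E_2$ and $j$ letters $E_1$. For elements $x,y$ of an associative algebra put $\widehat B_0=1$, $\widehat B_{n+1}=x\widehat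 B_n-\widehat B_nx+y\widehat B_n$ and $\widehat B^*_0=1$, $\widehat B^*_{n+1}=\widehat B^*_nx-x\widehat B^*_n+\widehat B^*_ny$, and let $\widehat B_{n,k}(x,y)$ and $\widehat B^*_{n,k}(x,y)$ be the parts of $\widehat B_n(x,y)$ and $\widehat B^*_n(x,y)$ that are homogeneous of degree $k$ in $y$ (so that $\widehat B_n(x,\lambda y)=\sum_k\lambda^k\widehat B_{n,k}(x,y)$ for a central indeterminate $\lambda$, and likewise for $\widehat B^*_n$). Then for all integers $0\le k\le n$: (a) $\widehat B_{n,k}(E_1,E_2)$ equals the sum of all terms of $\mathcal{SH}_{k,n-k}$ whose rightmost factor is not $E_1$; (b) dually, $\widehat B^*_{n,k}(E_2,E_1)$ equals the sum of all terms of $\mathcal{SH}_{n-k,k}$ whose leftmost factor is not $E_2$. (The empty product $1$ has neither a rightmost factor $E_1$ nor a leftmost factor $E_2$.) -/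

import Mathlib

/-- A Lyndon word over a totally ordered alphabet: a nonempty word that is strictly smaller,
in the lexicographic order (a proper prefix being smaller), than each of its proper rotations.
One-letter words satisfy the condition vacuously. -/
def IsLyndon {X : Type*} [LinearOrder X] (w : List X) : Prop :=
  w ≠ [] ∧ ∀ u v : List X, u ≠ [] → v ≠ [] → w = u ++ v → w < v ++ u

/-- Position `i` cuts `w` into two nonempty Lyndon words. The standard factorization of `w` is
the cut at the least such position, i.e. the one whose right factor has maximal length. -/
def IsLyndonCut {X : Type*} [LinearOrder X] (w : List X) (i : ℕ) : Prop :=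
  0 < i ∧ i < w.length ∧ IsLyndon (w.take i) ∧ IsLyndon (w.drop i)

open Classical in
/-- The Lyndon-Shirshov element `E_w` of the free algebra: `E_x = x` for a letter `x`, and
`E_w = [E_u, E_v]` if `w = uv` is the standard factorization of the Lyndon word `w`.
(The value is only meaningful when `w` is a Lyndon word.) -/
noncomputable def lyndonE (𝕜 : Type*) [Field 𝕜] {X : Type*} [LinearOrder X] (w : List X) :
    FreeAlgebra 𝕜 X :=
  if h : ∃ i, IsLyndonCut w i then
    lyndonE 𝕜 (w.take (Nat.find h)) * lyndonE 𝕜 (w.drop (Nat.find h)) -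
      lyndonE 𝕜 (w.drop (Nat.find h)) * lyndonE 𝕜 (w.take (Nat.find h))
  else
    (w.map (FreeAlgebra.ι 𝕜)).prod
termination_by w.length
decreasing_by
  all_goals
    obtain ⟨h1, h2, -⟩ := Nat.find_spec h
    simp only [List.length_take, List.length_drop]
    omega

/-- The index set of the PBW basis: non-increasing finite sequences of Lyndon words. -/
abbrev PBWIndex (X : Type*) [LinearOrder X] : Type _ :=
  {s : List (List X) // (∀ w ∈ s, IsLyndon w) ∧ s.Pairwise (fun u v => v ≤ u)}

/-- The PBW monomial `E_{α₁} E_{α₂} ⋯ E_{αₘ}` with `α₁ ≥ α₂ ≥ ⋯ ≥ αₘ` (repetitions give the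
powers; the empty sequence gives `1`). -/
noncomputable def pbwMonomial (𝕜 : Type*) [Field 𝕜] {X : Type*} [LinearOrder X]
    (s : PBWIndex X) : FreeAlgebra 𝕜 X :=
  (s.1.map (lyndonE 𝕜)).prod

open Classical in
/-- The sum of those terms of `f`, expanded in the basis `b`, whose index satisfies `p`. -/
noncomputable def sumOfTerms {𝕜 : Type*} [Field 𝕜] {ι A : Type*} [AddCommGroup A] [Module 𝕜 A]
    (b : Module.Basis ι 𝕜 A) (p : ι → Prop) (f : A) : A :=
  ((b.repr f).filter p).sum fun s c => c • b s

/-- The shuffle type polynomial `SH_{i,j}(y, x)`: the sum of all words of `(x + y)^(i + j)` in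
which `y` occurs `i` times and `x` occurs `j` times; `s` is the set of positions of `y`. -/
def shufflePoly {A : Type*} [Ring A] (y x : A) (i j : ℕ) : A :=
  ∑ s ∈ Finset.powersetCard i (Finset.univ : Finset (Fin (i + j))),
    (List.ofFn fun t => if t ∈ s then y else x).prod

/-- The Bell differential polynomial in `y` with respect to `x`:
`B₀ = 1`, `B_{n+1} = [x, Bₙ] + y Bₙ`. -/
def bellDiff {A : Type*} [Ring A] (x y : A) : ℕ → A
  | 0 => 1
  | n + 1 => (x * bellDiff x y n - bellDiff x y n * x) + y * bellDiff x y n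

/-- The dual Bell differential polynomial: `B*₀ = 1`, `B*_{n+1} = [B*ₙ, x] + B*ₙ y`. -/
def dualBellDiff {A : Type*} [Ring A] (x y : A) : ℕ → A
  | 0 => 1
  | n + 1 => (dualBellDiff x y n * x - x * dualBellDiff x y n) + dualBellDiff x y n * y

/-- The partial Bell differential polynomial `B_{n,k}(x, y)`, the part of `Bₙ(x, y)` homogeneous
of degree `k` in `y`: the coefficient of `λ^k` in `Bₙ(x, λ y)`, with `λ` a central
indeterminate. -/
noncomputable def partialBellDiff {A : Type*} [Ring A] (x y : A) (n k : ℕ) : A :=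
  (bellDiff (Polynomial.C x) (Polynomial.X * Polynomial.C y) n).coeff k

/-- The dual partial Bell differential polynomial `B*_{n,k}(x, y)`, the part of `B*ₙ(x, y)`
homogeneous of degree `k` in `y`. -/
noncomputable def dualPartialBellDiff {A : Type*} [Ring A] (x y : A) (n k : ℕ) : A :=
  (dualBellDiff (Polynomial.C x) (Polynomial.X * Polynomial.C y) n).coeff k

/-- The generator `E₁` of the free algebra on the ordered alphabet `1 < 2`, the letters `1`, `2`
being the elements `0`, `1` of `Fin 2`. -/
noncomputable abbrev genE₁ (𝕜 : Type*) [Field 𝕜] : FreeAlgebra 𝕜 (Fin 2) :=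
  FreeAlgebra.ι 𝕜 0

/-- The generator `E₂` of the free algebra on the ordered alphabet `1 < 2`. -/
noncomputable abbrev genE₂ (𝕜 : Type*) [Field 𝕜] : FreeAlgebra 𝕜 (Fin 2) :=
  FreeAlgebra.ι 𝕜 1

/-- The rightmost factor of the PBW monomial is not `E₁` (true for the empty monomial `1`). -/
def RightmostNotE₁ (s : PBWIndex (Fin 2)) : Prop :=
  s.1.getLast? ≠ some [0]

/-- The leftmost factor of the PBW monomial is not `E₂` (true for the empty monomial `1`). -/
def LeftmostNotE₂ (s : PBWIndex (Fin 2)) : Prop :=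
  s.1.head? ≠ some [1]

/-! ### Lexicographic order and the Lyndon factorization of words. -/

section LyndonWords

variable {X : Type*} [LinearOrder X]

/-! Let the free algebra act on itself with `E₁` acting as `[E₁, ·]` and `E₂` as left multiplication
(`bellAction`). The Bell recursion then says that `B_n(E₁, λE₂)` is `(E₁ + λE₂)^n` acting on `1`,
and the coefficient of `λ^k` in this power is `SH_{k,n-k}`. So the claim is that `f ↦ f · 1` is the
projection onto the terms whose rightmost factor is not `E₁`.

Every Lyndon element other than `E₁` acts by left multiplication: the right factor of a Lyndon
factorization is never the least letter, and the commutator of `[E₁, ·]` with left multiplication by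
`f` is left multiplication by `[E₁, f]`. As `E₁` comes last in the ordering of factors, a PBW
monomial not ending in `E₁` has no such factor and is sent to itself; one ending in `E₁` is killed,
since `[E₁, 1] = 0`. Part (b) is the mirror image, with a right action (`dualBellAction`) and the
greatest letter.

The basis property is triangularity: `pbwMonomial s` is the word `s.1.flatten` plus greater words of
the same length, and each word factors uniquely as a non-increasing product of Lyndon words. -/

theorem List.append_lt_append_iff_right (u : List X) {v w : List X} : u ++ v < u ++ w ↔ v < w := by
  induction u with
  | nil => rfl
  | cons a u ih => simpa using ih

theorem List.lt_append_of_ne_nil (u : List X) {v : List X} (hv : v ≠ []) : u < u ++ v := by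
  obtain ⟨a, v, rfl⟩ := List.exists_cons_of_ne_nil hv
  simpa using (List.append_lt_append_iff_right u).2 (List.nil_lt_cons a v)

theorem List.le_append (u v : List X) : u ≤ u ++ v := by
  rcases eq_or_ne v [] with rfl | hv
  · simp
  · exact (List.lt_append_of_ne_nil u hv).le

/-- If `u < v` then either `u` is a proper prefix of `v`, or the order is decided at a position
inside both words. -/
theorem List.prefix_or_append_lt_append {u v : List X} (h : u < v) :
    (∃ z, z ≠ [] ∧ v = u ++ z) ∨ ∀ a b, u ++ a < v ++ b := by
  induction u generalizing v with
  | nil => exact Or.inl ⟨v, by rintro rfl; exact lt_irrefl _ h, rfl⟩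
  | cons x u ih =>
    cases v with
    | nil => exact absurd h (List.not_lt_nil _)
    | cons y v =>
      rcases List.cons_lt_cons_iff.1 h with hxy | ⟨rfl, huv⟩
      · exact Or.inr fun a b => List.cons_lt_cons_iff.2 (Or.inl hxy)
      · rcases ih huv with ⟨z, hz, rfl⟩ | h'
        · exact Or.inl ⟨z, hz, rfl⟩
        · exact Or.inr fun a b => List.cons_lt_cons_iff.2 (Or.inr ⟨rfl, h' a b⟩)

theorem List.append_lt_append_of_lt_of_length {u v : List X} (h : u < v)
    (hl : v.length ≤ u.length) (a b : List X) : u ++ a < v ++ b := by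
  rcases List.prefix_or_append_lt_append h with ⟨z, hz, rfl⟩ | h'
  · have := List.length_pos_iff.2 hz
    simp only [List.length_append] at hl
    omega
  · exact h' a b

/-- Lexicographic comparison of concatenations, on words of equal lengths. -/
theorem List.append_lt_append_of_le_of_lt {u u' v v' : List X} (hl : u'.length = u.length)
    (hu : u ≤ u') (hv : v < v') : u ++ v < u' ++ v' := by
  rcases hu.lt_or_eq with h | rfl
  · exact List.append_lt_append_of_lt_of_length h hl.le _ _
  · exact (List.append_lt_append_iff_right u).2 hv

theorem List.append_lt_append_of_lt_of_le {u u' v v' : List X} (hl : u'.length = u.length)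
    (hu : u < u') : u ++ v < u' ++ v' :=
  List.append_lt_append_of_lt_of_length hu hl.le _ _

/-- If `v < w` were decided inside both words, then `v ++ u < w`, against the rotation inequality.
If instead `w = v ++ z`, the rotation `v ++ u` gives `z < u`, hence `z ++ v < u ++ v = w`, against
the rotation `z ++ v`. -/
theorem IsLyndon.lt_suffix {w : List X} (hw : IsLyndon w) {u v : List X} (hu : u ≠ [])
    (hv : v ≠ []) (h : w = u ++ v) : w < v := by
  have hrot := hw.2 u v hu hv h
  by_contra hlt
  have hvw : v < w := by
    refine lt_of_le_of_ne (not_lt.1 hlt) fun e => hu ?_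
    rw [h] at e
    exact List.append_left_eq_self.1 e.symm
  rcases List.prefix_or_append_lt_append hvw with ⟨z, hz, hz'⟩ | h'
  · have hlen : z.length = u.length := by
      have := congrArg List.length (h.symm.trans hz')
      simp only [List.length_append] at this
      omega
    have hzu : z < u := by
      rw [hz'] at hrot
      exact (List.append_lt_append_iff_right v).1 hrot
    have h1 : z ++ v < u ++ v := List.append_lt_append_of_lt_of_le hlen.symm hzu
    have h2 := hw.2 v z hv hz hz'
    rw [h] at h2
    exact lt_asymm h1 h2
  · have := h' u []
    rw [List.append_nil] at this
    exact lt_asymm this hrot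

theorem isLyndon_of_lt_suffix {w : List X} (hw : w ≠ [])
    (h : ∀ u v, u ≠ [] → v ≠ [] → w = u ++ v → w < v) : IsLyndon w :=
  ⟨hw, fun u v hu hv e => (h u v hu hv e).trans (List.lt_append_of_ne_nil v hu)⟩

theorem isLyndon_singleton (a : X) : IsLyndon [a] := by
  refine isLyndon_of_lt_suffix (by simp) fun u v hu hv e => ?_
  have := congrArg List.length e
  have hu' := List.length_pos_iff.2 hu
  have hv' := List.length_pos_iff.2 hv
  simp only [List.length_append, List.length_singleton] at this
  omega

/-- The concatenation of two Lyndon words in increasing order is a Lyndon word. -/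
theorem IsLyndon.append {u v : List X} (hu : IsLyndon u) (hv : IsLyndon v) (huv : u < v) :
    IsLyndon (u ++ v) := by
  have key : u ++ v < v := by
    rcases List.prefix_or_append_lt_append huv with ⟨z, hz, rfl⟩ | h
    · exact (List.append_lt_append_iff_right u).2 (hv.lt_suffix hu.1 hz rfl)
    · simpa using h v []
  refine isLyndon_of_lt_suffix (by simp [hu.1]) fun p q hp hq e => ?_
  -- The cut of `u ++ v` falls inside `v` or inside `u`.
  rcases List.append_eq_append_iff.1 e with ⟨r, rfl, rfl⟩ | ⟨r, rfl, rfl⟩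
  · rcases eq_or_ne r [] with rfl | hr
    · exact key
    · exact key.trans (hv.lt_suffix hr hq rfl)
  · rcases eq_or_ne r [] with rfl | hr
    · exact key
    · exact List.append_lt_append_of_lt_of_length (hu.lt_suffix hp hr rfl)
        (by simp) _ _

/-- A Lyndon word which is not a letter is a product of two Lyndon words. -/
theorem IsLyndon.exists_cut {w : List X} (hw : IsLyndon w) (hl : 1 < w.length) :
    ∃ i, IsLyndonCut w i := by
  -- The right factor is the lexicographically least proper nonempty suffix.
  obtain ⟨i, hi, hmin⟩ := Finset.exists_min_image (Finset.Ico 1 w.length) (fun i => w.drop i)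
    ⟨1, by simpa using hl⟩
  simp only [Finset.mem_Ico] at hi hmin
  have hwi : w.take i ++ w.drop i = w := List.take_append_drop i w
  have hlu : (w.take i).length = i := by simp; omega
  have hlv : (w.drop i).length = w.length - i := by simp
  have hmin' : ∀ p q : List X, p ≠ [] → q ≠ [] → w = p ++ q → w.drop i ≤ q := by
    intro p q hp hq e
    have h1 := List.length_pos_iff.2 hp
    have h2 := List.length_pos_iff.2 hq
    have := hmin p.length ⟨h1, by rw [e, List.length_append]; omega⟩
    simpa [e] using this
  clear hmin
  refine ⟨i, hi.1, hi.2, ?_, ?_⟩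
  · refine isLyndon_of_lt_suffix (List.length_pos_iff.1 (by omega)) fun p q hp hq e => ?_
    rw [e] at hwi hlu ⊢
    by_contra hlt
    have hne : q ≠ p ++ q := fun e' => hp (List.append_left_eq_self.1 e'.symm)
    have hq' : q < p ++ q := lt_of_le_of_ne (not_lt.1 hlt) hne
    -- If `q` is a prefix of the left factor `q ++ z`, cancelling `q` in `w < q ++ w.drop i` makes
    -- the suffix `z ++ w.drop i` smaller than the least one.
    rcases List.prefix_or_append_lt_append hq' with ⟨z, hz, hz'⟩ | h
    · have h1 := hmin' q (z ++ w.drop i) hq (by simp [hz])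
        (by rw [← List.append_assoc, ← hz', hwi])
      have h2 : w < q ++ w.drop i :=
        hw.lt_suffix hp (by simp [hq]) (by rw [← List.append_assoc, hwi])
      nth_rewrite 1 [← hwi] at h2
      rw [hz', List.append_assoc, List.append_lt_append_iff_right] at h2
      exact absurd h2 (not_lt.2 h1)
    · have h2 : w < q ++ w.drop i :=
        hw.lt_suffix hp (by simp [hq]) (by rw [← List.append_assoc, hwi])
      have h1 := h (w.drop i) (w.drop i)
      rw [hwi] at h1
      exact lt_asymm h1 h2
  · refine isLyndon_of_lt_suffix (List.length_pos_iff.1 (by omega)) fun p q hp hq e => ?_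
    refine lt_of_le_of_ne (hmin' (w.take i ++ p) q (by simp [hp]) hq
      (by rw [List.append_assoc, ← e, hwi])) fun e' => hp ?_
    rw [e] at e'
    exact List.append_left_eq_self.1 e'

/-- Prepending a Lyndon word to a non-increasing product of Lyndon words gives again such a
product. -/
theorem PBWIndex.exists_flatten_eq_append (s : List (List X)) :
    ∀ u : List X, IsLyndon u → (∀ w ∈ s, IsLyndon w) → s.Pairwise (fun u v => v ≤ u) →
      ∃ t : PBWIndex X, t.1.flatten = u ++ s.flatten := by
  induction s with
  | nil => exact fun u hu _ _ => ⟨⟨[u], by simpa using hu, by simp⟩, by simp⟩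
  | cons v s ih =>
    intro u hu hs hp
    rcases lt_or_ge u v with h | h
    · obtain ⟨t, ht⟩ := ih (u ++ v) (hu.append (hs v (by simp)) h)
        (fun w hw => hs w (by simp [hw])) hp.of_cons
      exact ⟨t, by simp [ht]⟩
    · refine ⟨⟨u :: v :: s, ?_, ?_⟩, by simp⟩
      · simpa [hu] using hs
      · refine List.pairwise_cons.2 ⟨fun w hw => ?_, hp⟩
        rcases List.mem_cons.1 hw with rfl | hw
        · exact h
        · exact ((List.pairwise_cons.1 hp).1 w hw).trans h

/-- Every word is a non-increasing product of Lyndon words. -/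
theorem PBWIndex.flatten_surjective (w : List X) : ∃ s : PBWIndex X, s.1.flatten = w := by
  induction w with
  | nil => exact ⟨⟨[], by simp, by simp⟩, by simp⟩
  | cons a w ih =>
    obtain ⟨s, rfl⟩ := ih
    exact PBWIndex.exists_flatten_eq_append s.1 [a] (isLyndon_singleton a) s.2.1 s.2.2

/-- A nonempty prefix of a product of words bounded by `c` has a nonempty suffix bounded by `c`. -/
theorem List.exists_suffix_le_of_append_eq_flatten {c : List X} (s : List (List X)) :
    ∀ u r : List X, u ≠ [] → (∀ w ∈ s, w ≤ c) → u ++ r = s.flatten →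
      ∃ p q, q ≠ [] ∧ u = p ++ q ∧ q ≤ c := by
  induction s with
  | nil =>
    intro u r hu _ h
    simp [hu] at h
  | cons v s ih =>
    intro u r hu hs h
    rw [List.flatten_cons] at h
    rcases List.append_eq_append_iff.1 h with ⟨z, rfl, _⟩ | ⟨z, rfl, hz⟩
    · exact ⟨[], u, hu, rfl, (List.le_append u z).trans (hs _ (by simp))⟩
    · rcases eq_or_ne z [] with rfl | hz'
      · exact ⟨[], v, by simpa using hu, by simp, hs v (by simp)⟩
      · obtain ⟨p, q, hq, rfl, hqc⟩ := ih z r hz' (fun w hw => hs w (by simp [hw])) hz.symm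
        exact ⟨v ++ p, q, hq, by simp, hqc⟩

/-- The first factor of a non-increasing product of Lyndon words is not a proper prefix of a
Lyndon prefix of the product. -/
theorem IsLyndon.eq_nil_of_append_eq_flatten {u z r : List X} {s : List (List X)}
    (hu : u ≠ []) (huz : IsLyndon (u ++ z)) (hs : ∀ w ∈ s, w ≤ u) (h : z ++ r = s.flatten) :
    z = [] := by
  by_contra hz
  -- A nonempty `z` would have a suffix `q ≤ u`, yet `q` is a proper suffix of the Lyndon word `u ++
  -- z` and so exceeds it.
  obtain ⟨p, q, hq, rfl, hqu⟩ := List.exists_suffix_le_of_append_eq_flatten s z r hz hs h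
  have := huz.lt_suffix (u := u ++ p) (v := q) (by simp [hu]) hq (by simp)
  exact absurd this (not_lt.2 (hqu.trans (List.le_append u _)))

/-- The factorization of a word into a non-increasing product of Lyndon words is unique. -/
theorem PBWIndex.flatten_injective :
    Function.Injective fun s : PBWIndex X => s.1.flatten := by
  rintro ⟨s, hs⟩ ⟨t, ht⟩ h
  simp only [Subtype.mk.injEq] at h ⊢
  induction s generalizing t with
  | nil =>
    cases t with
    | nil => rfl
    | cons v t => exact absurd h.symm (by simp [(ht.1 v (by simp)).1])
  | cons u s ih =>
    cases t with
    | nil => exact absurd h (by simp [(hs.1 u (by simp)).1])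
    | cons v t =>
      have hu := hs.1 u (by simp)
      have hv := ht.1 v (by simp)
      have hs' := List.pairwise_cons.1 hs.2
      have ht' := List.pairwise_cons.1 ht.2
      rw [List.flatten_cons, List.flatten_cons] at h
      have huv : u = v := by
        rcases List.append_eq_append_iff.1 h with ⟨z, rfl, hz⟩ | ⟨z, rfl, hz⟩
        · simp [IsLyndon.eq_nil_of_append_eq_flatten hu.1 hv hs'.1 hz.symm]
        · simp [IsLyndon.eq_nil_of_append_eq_flatten hv.1 hu ht'.1 hz.symm]
      subst huv
      rw [ih ⟨fun w hw => hs.1 w (by simp [hw]), hs'.2⟩ t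
        ⟨fun w hw => ht.1 w (by simp [hw]), ht'.2⟩ (List.append_cancel_left h)]

end LyndonWords

/-! ### Leading words and the PBW basis. -/

section LyndonBasis

variable (𝕜 : Type*) [Field 𝕜] {X : Type*}

/-- The monomial of the free algebra given by a word. -/
noncomputable def wordMonomial (w : List X) : FreeAlgebra 𝕜 X :=
  (w.map (FreeAlgebra.ι 𝕜)).prod

theorem wordMonomial_append (u v : List X) :
    wordMonomial 𝕜 (u ++ v) = wordMonomial 𝕜 u * wordMonomial 𝕜 v := by
  simp [wordMonomial]

theorem basisFreeMonoid_ofList (w : List X) :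
    FreeAlgebra.basisFreeMonoid 𝕜 X (FreeMonoid.ofList w) = wordMonomial 𝕜 w := by
  simp [FreeAlgebra.basisFreeMonoid, FreeAlgebra.equivMonoidAlgebraFreeMonoid, wordMonomial,
    FreeMonoid.lift_apply]

theorem span_range_wordMonomial :
    Submodule.span 𝕜 (Set.range (wordMonomial 𝕜 : List X → FreeAlgebra 𝕜 X)) = ⊤ := by
  rw [← (FreeAlgebra.basisFreeMonoid 𝕜 X).span_eq]
  congr 1
  ext f
  constructor
  · rintro ⟨w, rfl⟩
    exact ⟨_, basisFreeMonoid_ofList 𝕜 w⟩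
  · rintro ⟨w, rfl⟩
    exact ⟨_, (basisFreeMonoid_ofList 𝕜 (FreeMonoid.toList w)).symm⟩

variable [LinearOrder X]

/-- The span of the words that have the same length as `w` and are greater than `w`. -/
noncomputable def wordsAbove (w : List X) : Submodule 𝕜 (FreeAlgebra 𝕜 X) :=
  Submodule.span 𝕜 (wordMonomial 𝕜 '' {v | v.length = w.length ∧ w < v})

/-- The span of the words that have the same length as `w` and are at least `w`. -/
noncomputable def wordsFrom (w : List X) : Submodule 𝕜 (FreeAlgebra 𝕜 X) :=
  Submodule.span 𝕜 (wordMonomial 𝕜 '' {v | v.length = w.length ∧ w ≤ v})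

variable {𝕜}

theorem wordMonomial_mem_wordsFrom (w : List X) : wordMonomial 𝕜 w ∈ wordsFrom 𝕜 w :=
  Submodule.subset_span ⟨w, ⟨rfl, le_rfl⟩, rfl⟩

theorem wordsAbove_le_wordsFrom (w : List X) : wordsAbove 𝕜 w ≤ wordsFrom 𝕜 w :=
  Submodule.span_mono (Set.image_mono fun _ h => ⟨h.1, h.2.le⟩)

theorem wordsFrom_le_wordsAbove {v w : List X} (hl : w.length = v.length) (h : v < w) :
    wordsFrom 𝕜 w ≤ wordsAbove 𝕜 v :=
  Submodule.span_mono (Set.image_mono fun _ h' => ⟨h'.1.trans hl, h.trans_le h'.2⟩)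

theorem mem_wordsFrom_of_sub_mem {w : List X} {f : FreeAlgebra 𝕜 X}
    (hf : f - wordMonomial 𝕜 w ∈ wordsAbove 𝕜 w) : f ∈ wordsFrom 𝕜 w := by
  simpa using add_mem (wordsAbove_le_wordsFrom w hf) (wordMonomial_mem_wordsFrom w)

/-- Fixing the length in `wordsAbove` excludes proper prefixes, so a strict inequality between left
factors survives any right factors. -/
theorem mul_mem_wordsAbove_left {u v : List X} {f g : FreeAlgebra 𝕜 X}
    (hf : f ∈ wordsAbove 𝕜 u) (hg : g ∈ wordsFrom 𝕜 v) : f * g ∈ wordsAbove 𝕜 (u ++ v) := by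
  have h := Submodule.mul_mem_mul hf hg
  rw [wordsAbove, wordsFrom, Submodule.span_mul_span] at h
  refine Submodule.span_mono ?_ h
  rintro _ ⟨_, ⟨u', hu, rfl⟩, _, ⟨v', hv, rfl⟩, rfl⟩
  exact ⟨u' ++ v', ⟨by simp [hu.1, hv.1], List.append_lt_append_of_lt_of_le hu.1 hu.2⟩,
    wordMonomial_append 𝕜 u' v'⟩

theorem mul_mem_wordsAbove_right {u v : List X} {f g : FreeAlgebra 𝕜 X}
    (hf : f ∈ wordsFrom 𝕜 u) (hg : g ∈ wordsAbove 𝕜 v) : f * g ∈ wordsAbove 𝕜 (u ++ v) := by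
  have h := Submodule.mul_mem_mul hf hg
  rw [wordsAbove, wordsFrom, Submodule.span_mul_span] at h
  refine Submodule.span_mono ?_ h
  rintro _ ⟨_, ⟨u', hu, rfl⟩, _, ⟨v', hv, rfl⟩, rfl⟩
  exact ⟨u' ++ v', ⟨by simp [hu.1, hv.1], List.append_lt_append_of_le_of_lt hu.1 hu.2 hv.2⟩,
    wordMonomial_append 𝕜 u' v'⟩

/-- The property of having leading word `w`, with coefficient `1`, is multiplicative. -/
theorem mul_sub_wordMonomial_mem {u v : List X} {f g : FreeAlgebra 𝕜 X}
    (hf : f - wordMonomial 𝕜 u ∈ wordsAbove 𝕜 u) (hg : g - wordMonomial 𝕜 v ∈ wordsAbove 𝕜 v) :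
    f * g - wordMonomial 𝕜 (u ++ v) ∈ wordsAbove 𝕜 (u ++ v) := by
  have h := add_mem (mul_mem_wordsAbove_left hf (mem_wordsFrom_of_sub_mem hg))
    (mul_mem_wordsAbove_right (wordMonomial_mem_wordsFrom u) hg)
  convert h using 1
  rw [wordMonomial_append]
  noncomm_ring

theorem lyndonE_singleton (a : X) : lyndonE 𝕜 [a] = FreeAlgebra.ι 𝕜 a := by
  have h : ¬ ∃ i, IsLyndonCut [a] i := by
    rintro ⟨i, h1, h2, -⟩
    simp only [List.length_singleton] at h2
    omega
  rw [lyndonE, dif_neg h]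
  simp

/-- The Lyndon-Shirshov element of a Lyndon word which is not a letter is a commutator. -/
theorem IsLyndon.exists_lyndonE_eq {w : List X} (hw : IsLyndon w) (hl : 1 < w.length) :
    ∃ u v, IsLyndon u ∧ IsLyndon v ∧ w = u ++ v ∧
      lyndonE 𝕜 w = lyndonE 𝕜 u * lyndonE 𝕜 v - lyndonE 𝕜 v * lyndonE 𝕜 u := by
  classical
  have h := hw.exists_cut hl
  obtain ⟨-, -, h3, h4⟩ := Nat.find_spec h
  refine ⟨_, _, h3, h4, (List.take_append_drop _ w).symm, ?_⟩
  rw [lyndonE, dif_pos h]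

theorem IsLyndon.length_eq_one_or {w : List X} (hw : IsLyndon w) :
    (∃ a, w = [a]) ∨ 1 < w.length := by
  have := List.length_pos_iff.2 hw.1
  rcases (Nat.succ_le_of_lt this).eq_or_lt with h | h
  · exact Or.inl (List.length_eq_one_iff.1 h.symm)
  · exact Or.inr h

/-- Induction on Lyndon words along the standard factorization. -/
theorem IsLyndon.induction {p : List X → FreeAlgebra 𝕜 X → Prop}
    (letter : ∀ a, p [a] (FreeAlgebra.ι 𝕜 a))
    (comm : ∀ u v, IsLyndon u → IsLyndon v → IsLyndon (u ++ v) → p u (lyndonE 𝕜 u) →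
      p v (lyndonE 𝕜 v) → p (u ++ v) (lyndonE 𝕜 u * lyndonE 𝕜 v - lyndonE 𝕜 v * lyndonE 𝕜 u))
    {w : List X} (hw : IsLyndon w) : p w (lyndonE 𝕜 w) := by
  induction hn : w.length using Nat.strong_induction_on generalizing w with
  | _ n ih =>
    rcases hw.length_eq_one_or with ⟨a, rfl⟩ | hl
    · rw [lyndonE_singleton]
      exact letter a
    · obtain ⟨u, v, hu, hv, rfl, he⟩ := hw.exists_lyndonE_eq (𝕜 := 𝕜) hl
      have h1 := List.length_pos_iff.2 hu.1
      have h2 := List.length_pos_iff.2 hv.1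
      rw [List.length_append] at hn
      rw [he]
      exact comm u v hu hv hw (ih _ (by omega) hu rfl) (ih _ (by omega) hv rfl)

/-- The leading word of the Lyndon-Shirshov element `E_w` is `w`. -/
theorem IsLyndon.lyndonE_sub_mem {w : List X} (hw : IsLyndon w) :
    lyndonE 𝕜 w - wordMonomial 𝕜 w ∈ wordsAbove 𝕜 w := by
  refine hw.induction (p := fun w f => f - wordMonomial 𝕜 w ∈ wordsAbove 𝕜 w) (fun a => ?_)
    fun u v hu hv huv ihu ihv => ?_
  · simp [wordMonomial]
  · rw [sub_right_comm]
    -- The subtracted product has leading word `v ++ u`, a rotation of the Lyndon word `u ++ v` and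
    -- hence greater.
    exact sub_mem (mul_sub_wordMonomial_mem ihu ihv)
      (wordsFrom_le_wordsAbove (by simp [add_comm]) (huv.2 u v hu.1 hv.1 rfl)
        (mem_wordsFrom_of_sub_mem (mul_sub_wordMonomial_mem ihv ihu)))

/-- The leading word of a PBW monomial is the concatenation of its index. -/
theorem pbwMonomial_sub_mem (s : PBWIndex X) :
    pbwMonomial 𝕜 s - wordMonomial 𝕜 s.1.flatten ∈ wordsAbove 𝕜 s.1.flatten := by
  obtain ⟨s, hs, hp⟩ := s
  simp only [pbwMonomial]
  clear hp
  induction s with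
  | nil => simp [wordMonomial]
  | cons u s ih =>
    rw [List.map_cons, List.prod_cons, List.flatten_cons]
    exact mul_sub_wordMonomial_mem (hs u (by simp)).lyndonE_sub_mem
      (ih fun w hw => hs w (by simp [hw]))

theorem coord_wordMonomial (v w : List X) :
    (FreeAlgebra.basisFreeMonoid 𝕜 X).coord (FreeMonoid.ofList w) (wordMonomial 𝕜 v) =
      if v = w then 1 else 0 := by
  classical
  rw [← basisFreeMonoid_ofList, Module.Basis.coord_apply, Module.Basis.repr_self,
    Finsupp.single_apply]
  simp

theorem coord_eq_zero_of_mem_wordsAbove {v w : List X} (h : w ≤ v) {f : FreeAlgebra 𝕜 X}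
    (hf : f ∈ wordsAbove 𝕜 v) :
    (FreeAlgebra.basisFreeMonoid 𝕜 X).coord (FreeMonoid.ofList w) f = 0 := by
  have : wordsAbove 𝕜 v ≤
      LinearMap.ker ((FreeAlgebra.basisFreeMonoid 𝕜 X).coord (FreeMonoid.ofList w)) := by
    refine Submodule.span_le.2 ?_
    rintro _ ⟨u, ⟨-, hu⟩, rfl⟩
    simp [coord_wordMonomial, (h.trans_lt hu).ne', -Module.Basis.coord_apply]
  exact this hf

theorem coord_pbwMonomial {s : PBWIndex X} {w : List X} (h : w ≤ s.1.flatten) :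
    (FreeAlgebra.basisFreeMonoid 𝕜 X).coord (FreeMonoid.ofList w) (pbwMonomial 𝕜 s) =
      if s.1.flatten = w then 1 else 0 := by
  have := coord_eq_zero_of_mem_wordsAbove h (pbwMonomial_sub_mem (𝕜 := 𝕜) s)
  rwa [map_sub, sub_eq_zero, coord_wordMonomial] at this

/-- In a vanishing combination, the least leading word with nonzero coefficient occurs in no other
term. -/
theorem linearIndependent_pbwMonomial :
    LinearIndependent 𝕜 (pbwMonomial 𝕜 : PBWIndex X → FreeAlgebra 𝕜 X) := by
  classical
  rw [linearIndependent_iff']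
  intro S g h
  by_contra! hne
  obtain ⟨s₀, hs₀⟩ := hne
  obtain ⟨s, hs, hmin⟩ := (S.filter fun s => g s ≠ 0).exists_min_image (fun s => s.1.flatten)
    ⟨s₀, by simpa using hs₀⟩
  simp only [Finset.mem_filter] at hs hmin
  refine hs.2 ?_
  have := congrArg ((FreeAlgebra.basisFreeMonoid 𝕜 X).coord (FreeMonoid.ofList s.1.flatten)) h
  rw [map_sum, map_zero, Finset.sum_eq_single s] at this
  · rwa [map_smul, coord_pbwMonomial le_rfl, if_pos rfl, smul_eq_mul, mul_one] at this
  · intro t ht hts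
    rw [map_smul]
    by_cases hg : g t = 0
    · rw [hg, zero_smul]
    · rw [coord_pbwMonomial (hmin t ⟨ht, hg⟩),
        if_neg fun e => hts (PBWIndex.flatten_injective e), smul_zero]
  · exact fun h' => absurd hs.1 h'

theorem span_range_pbwMonomial [Finite X] :
    Submodule.span 𝕜 (Set.range (pbwMonomial 𝕜 : PBWIndex X → FreeAlgebra 𝕜 X)) = ⊤ := by
  rw [eq_top_iff, ← span_range_wordMonomial, Submodule.span_le]
  rintro _ ⟨w, rfl⟩
  -- Finiteness makes `>` well-founded on words of this length, which permits descending induction.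
  have : Finite {v : List X // v.length = w.length} :=
    (List.finite_length_eq X w.length).to_subtype
  suffices ∀ v : {v : List X // v.length = w.length}, wordMonomial 𝕜 v.1 ∈
      Submodule.span 𝕜 (Set.range (pbwMonomial 𝕜 : PBWIndex X → FreeAlgebra 𝕜 X)) from
    this ⟨w, rfl⟩
  intro v
  induction v using WellFoundedGT.induction with
  | _ v ih =>
    obtain ⟨v, hv⟩ := v
    obtain ⟨s, rfl⟩ := PBWIndex.flatten_surjective v
    have h : wordsAbove 𝕜 s.1.flatten ≤
        Submodule.span 𝕜 (Set.range (pbwMonomial 𝕜 : PBWIndex X → FreeAlgebra 𝕜 X)) := by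
      refine Submodule.span_le.2 ?_
      rintro _ ⟨u, ⟨hu, hlt⟩, rfl⟩
      exact ih ⟨u, hu.trans hv⟩ hlt
    simpa using sub_mem (Submodule.subset_span (Set.mem_range_self s)) (h (pbwMonomial_sub_mem s))

variable (𝕜 X) in
/-- The Lyndon-Shirshov PBW basis of the free algebra. -/
noncomputable def pbwBasis [Finite X] : Module.Basis (PBWIndex X) 𝕜 (FreeAlgebra 𝕜 X) :=
  Module.Basis.mk linearIndependent_pbwMonomial span_range_pbwMonomial.ge

theorem pbwBasis_apply [Finite X] (s : PBWIndex X) : pbwBasis 𝕜 X s = pbwMonomial 𝕜 s := by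
  simp [pbwBasis]

end LyndonBasis

/-! ### Shuffle polynomials as coefficients of a power of a binomial. -/

section Bell

-- Induction on `n`: the first letter is `x` or `y` according to whether `0 ∈ s`, matching the first
-- factor of the power.
open Polynomial in
theorem sum_powersetCard_ofFn_prod {A : Type*} [Ring A] (y x : A) (n i : ℕ) :
    ∑ s ∈ Finset.powersetCard i (Finset.univ : Finset (Fin n)),
      (List.ofFn fun t => if t ∈ s then y else x).prod = ((C x + X * C y) ^ n).coeff i := by
  induction n generalizing i with
  | zero =>
    cases i with
    | zero => simp
    | succ i =>
      rw [Finset.powersetCard_eq_empty.2 (by simp)]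
      simp [coeff_one]
  | succ n ih =>
    have h0 : (0 : Fin (n + 1)) ∉ Finset.univ.map (Fin.succEmb n) := by simp
    have hx : ∀ i, ∑ s ∈ Finset.powersetCard i (Finset.univ.map (Fin.succEmb n)),
        (List.ofFn fun t => if t ∈ s then y else x).prod = x * ((C x + X * C y) ^ n).coeff i := by
      intro i
      rw [← ih, Finset.powersetCard_map, Finset.sum_map, Finset.mul_sum]
      refine Finset.sum_congr rfl fun s _ => ?_
      simp [List.ofFn_succ, Finset.mapEmbedding_apply]
    have huniv : (Finset.univ : Finset (Fin (n + 1))) =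
        insert 0 (Finset.univ.map (Fin.succEmb n)) := by
      rw [Fin.univ_succ, Finset.cons_eq_insert]
      rfl
    rw [pow_succ', add_mul, coeff_add, coeff_C_mul, mul_assoc]
    cases i with
    | zero =>
      rw [← hx, coeff_X_mul_zero, add_zero]
      simp
    | succ i =>
      have hdisj : Disjoint (Finset.powersetCard (i + 1) (Finset.univ.map (Fin.succEmb n)))
          ((Finset.powersetCard i (Finset.univ.map (Fin.succEmb n))).image (insert 0)) := by
        rw [Finset.disjoint_left]
        intro s hs hs'
        obtain ⟨t, -, rfl⟩ := Finset.mem_image.1 hs'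
        exact h0 ((Finset.mem_powersetCard.1 hs).1 (Finset.mem_insert_self _ _))
      rw [huniv, Finset.powersetCard_succ_insert h0, Finset.sum_union hdisj, hx, coeff_X_mul,
        coeff_C_mul, Finset.sum_image, Finset.powersetCard_map, Finset.sum_map, ← ih i,
        Finset.mul_sum]
      · congr 1
        refine Finset.sum_congr rfl fun s _ => ?_
        simp [List.ofFn_succ, Finset.mapEmbedding_apply]
      · intro s hs t ht hst
        have hs0 : 0 ∉ s := fun h => h0 ((Finset.mem_powersetCard.1 hs).1 h)
        have ht0 : 0 ∉ t := fun h => h0 ((Finset.mem_powersetCard.1 ht).1 h)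
        rw [← Finset.erase_insert hs0, ← Finset.erase_insert ht0, hst]

open Polynomial in
theorem shufflePoly_eq_coeff {A : Type*} [Ring A] (y x : A) (i j : ℕ) :
    shufflePoly y x i j = ((C x + X * C y) ^ (i + j)).coeff i :=
  sum_powersetCard_ofFn_prod y x (i + j) i

-- Complementing the set of positions exchanges the two letters.
open Polynomial in
theorem shufflePoly_eq_coeff_swap {A : Type*} [Ring A] (y x : A) (i j : ℕ) :
    shufflePoly y x i j = ((C y + X * C x) ^ (i + j)).coeff j := by
  rw [← sum_powersetCard_ofFn_prod]
  refine Finset.sum_nbij' compl compl (fun s hs => ?_) (fun s hs => ?_) (by simp) (by simp)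
    fun s _ => ?_
  · simp only [Finset.mem_powersetCard_univ, Finset.card_compl, Fintype.card_fin] at hs ⊢
    omega
  · simp only [Finset.mem_powersetCard_univ, Finset.card_compl, Fintype.card_fin] at hs ⊢
    omega
  · congr 2
    ext t
    by_cases h : t ∈ s <;> simp [h]

theorem sumOfTerms_eq_of_forall {𝕜 ι A : Type*} [Field 𝕜] [AddCommGroup A] [Module 𝕜 A]
    (b : Module.Basis ι 𝕜 A) (p : ι → Prop) (P : A →ₗ[𝕜] A) (h₁ : ∀ s, p s → P (b s) = b s)
    (h₀ : ∀ s, ¬ p s → P (b s) = 0) (f : A) : sumOfTerms b p f = P f := by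
  classical
  conv_rhs => rw [← b.linearCombination_repr f, Finsupp.linearCombination_apply, map_finsuppSum]
  rw [sumOfTerms, Finsupp.sum_filter_index, Finsupp.sum, Finsupp.support_filter, Finset.sum_filter]
  refine Finset.sum_congr rfl fun s _ => ?_
  by_cases h : p s <;> simp [h, h₁, h₀]

/-! ### The Bell actions and the projections they define. -/

variable (𝕜 : Type*) [Field 𝕜]

/-- The action of the free algebra on itself in which `E₁` acts by the commutator `[E₁, ·]` and
`E₂` acts by left multiplication. -/
noncomputable def bellAction :
    FreeAlgebra 𝕜 (Fin 2) →ₐ[𝕜] Module.End 𝕜 (FreeAlgebra 𝕜 (Fin 2)) :=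
  FreeAlgebra.lift 𝕜
    ![LinearMap.mulLeft 𝕜 (genE₁ 𝕜) - LinearMap.mulRight 𝕜 (genE₁ 𝕜),
      LinearMap.mulLeft 𝕜 (genE₂ 𝕜)]

/-- The right action of the free algebra on itself in which `E₂` acts by the commutator
`[·, E₂]` and `E₁` acts by right multiplication. -/
noncomputable def dualBellAction :
    FreeAlgebra 𝕜 (Fin 2) →ₐ[𝕜] (Module.End 𝕜 (FreeAlgebra 𝕜 (Fin 2)))ᵐᵒᵖ :=
  FreeAlgebra.lift 𝕜
    ![MulOpposite.op (LinearMap.mulRight 𝕜 (genE₁ 𝕜)),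
      MulOpposite.op (LinearMap.mulRight 𝕜 (genE₂ 𝕜) - LinearMap.mulLeft 𝕜 (genE₂ 𝕜))]

variable {𝕜}

theorem bellAction_genE₁ (f : FreeAlgebra 𝕜 (Fin 2)) :
    bellAction 𝕜 (genE₁ 𝕜) f = genE₁ 𝕜 * f - f * genE₁ 𝕜 := by
  simp [bellAction]

theorem bellAction_genE₂ (f : FreeAlgebra 𝕜 (Fin 2)) :
    bellAction 𝕜 (genE₂ 𝕜) f = genE₂ 𝕜 * f := by
  simp [bellAction]

theorem dualBellAction_genE₁ (f : FreeAlgebra 𝕜 (Fin 2)) :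
    (dualBellAction 𝕜 (genE₁ 𝕜)).unop f = f * genE₁ 𝕜 := by
  simp [dualBellAction]

theorem dualBellAction_genE₂ (f : FreeAlgebra 𝕜 (Fin 2)) :
    (dualBellAction 𝕜 (genE₂ 𝕜)).unop f = f * genE₂ 𝕜 - genE₂ 𝕜 * f := by
  simp [dualBellAction]

theorem singleton_zero_le {w : List (Fin 2)} (hw : w ≠ []) : [0] ≤ w := by
  obtain ⟨a, w, rfl⟩ := List.exists_cons_of_ne_nil hw
  refine le_trans ?_ (List.le_append [a] w)
  rcases (Fin.zero_le a).lt_or_eq with h | h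
  · exact (List.cons_lt_cons_iff.2 (Or.inl h)).le
  · rw [← h]

/-- A Lyndon word is at most its last letter. -/
theorem IsLyndon.le_singleton_one {w : List (Fin 2)} (hw : IsLyndon w) : w ≤ [1] := by
  have hb : ∀ b : Fin 2, [b] ≤ [1] := by
    intro b
    rcases (Fin.le_last b).lt_or_eq with h | h
    · exact (List.cons_lt_cons_iff.2 (Or.inl h)).le
    · rw [h]; exact le_rfl
  rcases List.eq_nil_or_concat' w with h | ⟨p, b, h⟩
  · exact absurd h hw.1
  · refine le_trans ?_ (hb b)
    rcases eq_or_ne p [] with rfl | hp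
    · rw [h, List.nil_append]
    · exact (hw.lt_suffix hp (by simp) h).le

/-- Lyndon-Shirshov elements other than `E₁` act by left multiplication. -/
theorem IsLyndon.bellAction_lyndonE {w : List (Fin 2)} (hw : IsLyndon w) (h : w ≠ [0])
    (f : FreeAlgebra 𝕜 (Fin 2)) : bellAction 𝕜 (lyndonE 𝕜 w) f = lyndonE 𝕜 w * f := by
  revert h f
  refine hw.induction (p := fun w z => w ≠ [0] → ∀ f, bellAction 𝕜 z f = z * f) (fun a ha f => ?_)
    fun u v hu hv huv ihu ihv _ f => ?_
  · obtain rfl : a = 1 := by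
      have : a ≠ 0 := fun h => ha (by rw [h])
      omega
    exact bellAction_genE₂ f
  · have hv0 : v ≠ [0] := by
      rintro rfl
      exact absurd (huv.lt_suffix hu.1 (by simp) rfl)
        (not_lt.2 (singleton_zero_le (by simp)))
    by_cases hu0 : u = [0]
    · subst hu0
      simp only [map_sub, map_mul, LinearMap.sub_apply, Module.End.mul_apply, ihv hv0,
        lyndonE_singleton, bellAction_genE₁]
      noncomm_ring
    · simp only [map_sub, map_mul, LinearMap.sub_apply, Module.End.mul_apply, ihv hv0, ihu hu0]
      noncomm_ring

/-- Lyndon-Shirshov elements other than `E₂` act by right multiplication. -/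
theorem IsLyndon.dualBellAction_lyndonE {w : List (Fin 2)} (hw : IsLyndon w) (h : w ≠ [1])
    (f : FreeAlgebra 𝕜 (Fin 2)) :
    (dualBellAction 𝕜 (lyndonE 𝕜 w)).unop f = f * lyndonE 𝕜 w := by
  revert h f
  refine hw.induction (p := fun w z => w ≠ [1] → ∀ f, (dualBellAction 𝕜 z).unop f = f * z)
    (fun a ha f => ?_) fun u v hu hv huv ihu ihv _ f => ?_
  · obtain rfl : a = 0 := by
      have : a ≠ 1 := fun h => ha (by rw [h])
      omega
    exact dualBellAction_genE₁ f
  · have hu1 : u ≠ [1] := by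
      rintro rfl
      exact absurd ((List.lt_append_of_ne_nil [1] hv.1).trans (huv.lt_suffix hu.1 hv.1 rfl))
        (not_lt.2 hv.le_singleton_one)
    by_cases hv1 : v = [1]
    · subst hv1
      simp only [map_sub, map_mul, MulOpposite.unop_sub, MulOpposite.unop_mul,
        LinearMap.sub_apply, Module.End.mul_apply, ihu hu1, lyndonE_singleton,
        dualBellAction_genE₂]
      noncomm_ring
    · simp only [map_sub, map_mul, MulOpposite.unop_sub, MulOpposite.unop_mul,
        LinearMap.sub_apply, Module.End.mul_apply, ihu hu1, ihv hv1]
      noncomm_ring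

/-- `[0]` is the least Lyndon word, so if it occurs in a non-increasing sequence it is also the last
entry. -/
theorem RightmostNotE₁.ne_of_mem {s : PBWIndex (Fin 2)} (hs : RightmostNotE₁ s) :
    ∀ w ∈ s.1, w ≠ [0] := by
  obtain ⟨s, hl, hp⟩ := s
  rintro w hw rfl
  simp only [RightmostNotE₁] at hs hw
  rcases List.eq_nil_or_concat' s with rfl | ⟨l, a, rfl⟩
  · simp at hw
  · have ha : a ≠ [0] := by simpa using hs
    have hl0 : [0] ∈ l := by simpa [ha.symm] using hw
    exact ha (le_antisymm ((List.pairwise_append.1 hp).2.2 _ hl0 a (by simp))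
      (singleton_zero_le (hl a (by simp)).1))

theorem LeftmostNotE₂.ne_of_mem {s : PBWIndex (Fin 2)} (hs : LeftmostNotE₂ s) :
    ∀ w ∈ s.1, w ≠ [1] := by
  obtain ⟨s, hl, hp⟩ := s
  rintro w hw rfl
  simp only [LeftmostNotE₂] at hs hw
  cases s with
  | nil => simp at hw
  | cons a l =>
    have ha : a ≠ [1] := by simpa using hs
    have hl1 : [1] ∈ l := by simpa [ha.symm] using hw
    exact ha (le_antisymm (hl a (by simp)).le_singleton_one
      ((List.pairwise_cons.1 hp).1 _ hl1))

theorem bellAction_prod_apply_one {s : List (List (Fin 2))} (hl : ∀ w ∈ s, IsLyndon w)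
    (h : ∀ w ∈ s, w ≠ [0]) :
    bellAction 𝕜 (s.map (lyndonE 𝕜)).prod 1 = (s.map (lyndonE 𝕜)).prod := by
  induction s with
  | nil => simp
  | cons u s ih =>
    rw [List.map_cons, List.prod_cons, map_mul, Module.End.mul_apply,
      ih (fun w hw => hl w (by simp [hw])) (fun w hw => h w (by simp [hw])),
      (hl u (by simp)).bellAction_lyndonE (h u (by simp))]

/-- A right action applies the head first, so the induction needs an arbitrary `f` and not just `1`.
-/
theorem dualBellAction_prod_apply {s : List (List (Fin 2))} (hl : ∀ w ∈ s, IsLyndon w)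
    (h : ∀ w ∈ s, w ≠ [1]) (f : FreeAlgebra 𝕜 (Fin 2)) :
    (dualBellAction 𝕜 (s.map (lyndonE 𝕜)).prod).unop f = f * (s.map (lyndonE 𝕜)).prod := by
  induction s generalizing f with
  | nil => simp
  | cons u s ih =>
    rw [List.map_cons, List.prod_cons, map_mul, MulOpposite.unop_mul, Module.End.mul_apply,
      ih (fun w hw => hl w (by simp [hw])) (fun w hw => h w (by simp [hw])),
      (hl u (by simp)).dualBellAction_lyndonE (h u (by simp)), mul_assoc]

theorem sumOfTerms_rightmostNotE₁ (f : FreeAlgebra 𝕜 (Fin 2)) :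
    sumOfTerms (pbwBasis 𝕜 (Fin 2)) RightmostNotE₁ f = bellAction 𝕜 f 1 := by
  refine sumOfTerms_eq_of_forall _ _
    ((LinearMap.applyₗ (1 : FreeAlgebra 𝕜 (Fin 2))).comp (bellAction 𝕜).toLinearMap)
    (fun s hs => ?_) (fun s hs => ?_) f
  · simpa [pbwBasis_apply, pbwMonomial] using bellAction_prod_apply_one s.2.1 hs.ne_of_mem
  · obtain ⟨l, hl⟩ := List.getLast?_eq_some_iff.1 (not_not.1 hs)
    simp [pbwBasis_apply, pbwMonomial, hl, lyndonE_singleton, bellAction_genE₁]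

theorem sumOfTerms_leftmostNotE₂ (f : FreeAlgebra 𝕜 (Fin 2)) :
    sumOfTerms (pbwBasis 𝕜 (Fin 2)) LeftmostNotE₂ f = (dualBellAction 𝕜 f).unop 1 := by
  refine sumOfTerms_eq_of_forall _ _
    ((LinearMap.applyₗ (1 : FreeAlgebra 𝕜 (Fin 2))).comp
      ((MulOpposite.opLinearEquiv 𝕜).symm.toLinearMap.comp (dualBellAction 𝕜).toLinearMap))
    (fun s hs => ?_) (fun s hs => ?_) f
  · simpa [pbwBasis_apply, pbwMonomial] using dualBellAction_prod_apply s.2.1 hs.ne_of_mem 1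
  · obtain ⟨l, hl⟩ := List.head?_eq_some_iff.1 (not_not.1 hs)
    simp [pbwBasis_apply, pbwMonomial, hl, lyndonE_singleton, dualBellAction_genE₂]

-- Splitting off the leftmost factor of the power reproduces the recursion `B_{n+1,k+1} = [E₁,
-- B_{n,k+1}] + E₂ B_{n,k}`.
open Polynomial in
theorem partialBellDiff_eq_bellAction (n k : ℕ) :
    partialBellDiff (genE₁ 𝕜) (genE₂ 𝕜) n k =
      bellAction 𝕜 (((C (genE₁ 𝕜) + X * C (genE₂ 𝕜)) ^ n).coeff k) 1 := by
  unfold partialBellDiff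
  induction n generalizing k with
  | zero => cases k <;> simp [bellDiff, coeff_one]
  | succ n ih =>
    rw [pow_succ', add_mul, bellDiff]
    cases k with
    | zero => simp [-X_mul_C, mul_assoc, ih, bellAction_genE₁]
    | succ k =>
      simp [-X_mul_C, mul_assoc, ih, bellAction_genE₁, bellAction_genE₂, coeff_X_mul]

open Polynomial in
theorem dualPartialBellDiff_eq_dualBellAction (n k : ℕ) :
    dualPartialBellDiff (genE₂ 𝕜) (genE₁ 𝕜) n k =
      (dualBellAction 𝕜 (((C (genE₂ 𝕜) + X * C (genE₁ 𝕜)) ^ n).coeff k)).unop 1 := by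
  unfold dualPartialBellDiff
  induction n generalizing k with
  | zero => cases k <;> simp [dualBellDiff, coeff_one]
  | succ n ih =>
    -- In the right action the rightmost factor acts last, so the power is split on the right.
    rw [pow_succ, mul_add, dualBellDiff, ← mul_assoc, ← mul_assoc, coeff_add, coeff_add, coeff_sub,
      coeff_mul_C, coeff_mul_C, coeff_mul_C, coeff_mul_C, coeff_C_mul, ih]
    cases k with
    | zero =>
      rw [coeff_mul_X_zero, coeff_mul_X_zero, zero_mul, add_zero, add_zero, map_mul,
        MulOpposite.unop_mul, Module.End.mul_apply, dualBellAction_genE₂]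
    | succ k =>
      rw [coeff_mul_X, coeff_mul_X, ih, map_add, map_mul, map_mul, MulOpposite.unop_add,
        MulOpposite.unop_mul, MulOpposite.unop_mul, LinearMap.add_apply, Module.End.mul_apply,
        Module.End.mul_apply, dualBellAction_genE₁, dualBellAction_genE₂]

end Bell

/-- The Lyndon-Shirshov PBW monomials form a basis of the free algebra on `1 < 2`, and with
respect to it the partial Bell differential polynomials are the indicated partial sums of terms
of the shuffle type polynomials. -/
theorem theoremC (𝕜 : Type*) [Field 𝕜] :
    ∃ b : Module.Basis (PBWIndex (Fin 2)) 𝕜 (FreeAlgebra 𝕜 (Fin 2)),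
      (∀ s, b s = pbwMonomial 𝕜 s) ∧
      (∀ n k : ℕ, k ≤ n →
        partialBellDiff (genE₁ 𝕜) (genE₂ 𝕜) n k =
          sumOfTerms b RightmostNotE₁ (shufflePoly (genE₂ 𝕜) (genE₁ 𝕜) k (n - k))) ∧
      (∀ n k : ℕ, k ≤ n →
        dualPartialBellDiff (genE₂ 𝕜) (genE₁ 𝕜) n k =
          sumOfTerms b LeftmostNotE₂ (shufflePoly (genE₂ 𝕜) (genE₁ 𝕜) (n - k) k)) := by
  refine ⟨pbwBasis 𝕜 (Fin 2), pbwBasis_apply, fun n k hk => ?_, fun n k hk => ?_⟩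
  · rw [sumOfTerms_rightmostNotE₁, partialBellDiff_eq_bellAction, shufflePoly_eq_coeff,
      Nat.add_sub_cancel' hk]
  · rw [sumOfTerms_leftmostNotE₂, dualPartialBellDiff_eq_dualBellAction,
      shufflePoly_eq_coeff_swap, Nat.sub_add_cancel hk]
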